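/- **Setting.** Let $N\ge 1$, let $q\in\mathbb{C}$ with $q\ne0$, $q^2\neq 1$, and let $\eta_1,\dots,\eta_N\in\mathbb{C}\setminus\{0\}$ satisfy $$\eta_a^2\neq q^{2j}\eta_b^2\qquad\text{for all } a<b,\ j\in\{-1,0,1\}.$$ On $\mathcal R_N=(\mathbb{C}^2)^{\otimes N}$ let $\sigma_n^z,\sigma_n^\pm$ be the Pauli matrices ($\sigma^+=\begin{pmatrix}0&1\\0&0\end{pmatrix}$, $\sigma^-=\begin{pmatrix}0&0\\1&0\end{pmatrix}$) acting on the $n$-th factor, put $x_\pm(\lambda)=\tfrac12\left(\lambda q-\tfrac1{q\lambda}\pm(\lambda-\tfrac1\lambda)\right)$, and define the Lax operators and the monodromy matrix of the inhomogeneous six-vertex model by $$L_n(\lambda)=\begin{pmatrix}x_+(\lambda)+x_-(\lambda)\sigma_n^z&(q-q^{-1})\sigma_n^-\\(q-q^{-1})\sigma_n^+&x_+(\lambda)-x_-(\lambda)\sigma_n^z\end{pmatrix},\qquad \begin{pmatrix}A(\lambda)&B(\lambda)\\C(\lambda)&D(\lambda)\end{pmatrix}=L_N(\lambda/\eta_N)\cdots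 L_1(\lambda/\eta_1).$$ Put $a(\lambda)=-\prod_{n=1}^N\left(\frac{\lambda q}{\eta_n}-\frac{\eta_n}{\lambda q}\right)$, $d(\lambda)=\prod_{n=1}^N\left(\frac{\lambda}{\eta_n}-\frac{\eta_n}{\lambda}\right)$ and $\omega(x)=x^{N-1}$. Let $|0\rangle\in\mathcal R_N$ be the all-spins-up vector, $\langle 0|\in\mathcal R_N^*$ the dual spin basis covector, and let $\textsc{n}=\prod_{1\le b<a\le N}(\eta_a/\eta_b-\eta_b/\eta_a)^{1/2}$, for any fixed choice of the square roots. For $\mathbf h=(h_1,\dots,h_N)\in\{0,1\}^N$ let $$\langle \mathbf h|=\frac1{\textsc{n}}\langle0|\prod_{n=1}^N\left(\frac{C(\eta_n)}{d(\eta_n/q)}\right)^{h_n},\qquad |\mathbf h\rangle=\frac1{\textsc{n}}\prod_{n=1}^N\left(\frac{B(\eta_n)}{a(\eta_n)}\right)^{h_n}|0\rangle .$$ For arbitrary functions $\alpha_1,\dots,\alpha_N,\beta_1,\dots,\beta_N:\mathbb{C}\to\mathbb{C}$ define the left and right separate states $$\langle\alpha|=\sum_{\mathbf h\in\{0,1\}^N}\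 \prod_{a=1}^N\frac{\alpha_a(\eta_aq^{-h_a})}{\omega(\eta_aq^{-h_a})}\prod_{1\le b<a\le N}\left(\eta_a^2q^{-2h_a}-\eta_b^2q^{-2h_b}\right)\langle\mathbf h|,$$ $$|\beta\rangle=\sum_{\mathbf h\in\{0,1\}^N}\ \prod_{a=1}^N\frac{\beta_a(\eta_aq^{-h_a})}{\omega(\eta_aq^{-h_a})}\prod_{1\le b<a\le N}\left(\eta_a^2q^{-2h_a}-\eta_b^2q^{-2h_b}\right)|\mathbf h\rangle .$$ **Proposition.** The action $\langle\alpha|\beta\rangle$ of the covector $\langle\alpha|$ on the vector $|\beta\rangle$, which is also the Hermitian scalar product $\left((\langle\alpha|)^\dagger,|\beta\rangle\right)$ in $\mathcal R_N$ (the spin basis being orthonormal, and the product conjugate-linear in the first argument), is the $N\times N$ determinant $$\langle\alpha|\beta\rangle=\det\left(\mathcal M_{a,b}\right)_{1\le a,b\le N},\qquad \mathcal M_{a,b}=\eta_a^{2(b-1)}\sum_{h=0}^1\frac{\alpha_a(\eta_aq^{-h})\,\beta_a(\eta_aq^{-h})}{\omega(\eta_aq^{-h})}\,q^{-2(b-1)h}.$$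 -/

import Mathlib

open scoped Matrix

noncomputable section

namespace SixVertex

/-- Elements of `{0,1}^N`.  They label the spin basis of the quantum space
`ℂ² ⊗ ⋯ ⊗ ℂ²` (`0` is the `σᶻ`-eigenvalue `+1`, `1` is the eigenvalue `-1`), and also the
separation-of-variables states `(h_1,…,h_N)`. -/
abbrev Config (N : ℕ) := Fin N → Fin 2

/-- The quantum space `ℂ² ⊗ ⋯ ⊗ ℂ²`, in coordinates for the spin basis. -/
abbrev Ket (N : ℕ) := Config N → ℂ

/-- The dual of the quantum space, in coordinates for the dual spin basis (row vectors). -/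
abbrev Bra (N : ℕ) := Config N → ℂ

/-- Operators on the quantum space.  They act on kets by `*ᵥ` and on bras by `ᵥ*`. -/
abbrev Op (N : ℕ) := Matrix (Config N) (Config N) ℂ

/-- The Pauli matrix `σᶻ`. -/
def sigmaZ : Matrix (Fin 2) (Fin 2) ℂ := !![1, 0; 0, -1]

/-- The raising matrix `σ⁺`. -/
def sigmaPlus : Matrix (Fin 2) (Fin 2) ℂ := !![0, 1; 0, 0]

/-- The lowering matrix `σ⁻`. -/
def sigmaMinus : Matrix (Fin 2) (Fin 2) ℂ := !![0, 0; 1, 0]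

/-- `1 ⊗ ⋯ ⊗ s ⊗ ⋯ ⊗ 1` with `s` acting on the `n`-th factor. -/
def siteOp {N : ℕ} (n : Fin N) (s : Matrix (Fin 2) (Fin 2) ℂ) : Op N :=
  Matrix.of fun h k => ∏ m : Fin N, (if m = n then s else 1) (h m) (k m)

/-- `x₊(lam) = (lam q - 1/(q lam) + lam - 1/lam) / 2`. -/
def xPlus (q lam : ℂ) : ℂ := (lam * q - (q * lam)⁻¹ + lam - lam⁻¹) / 2

/-- `x₋(lam) = (lam q - 1/(q lam) - lam + 1/lam) / 2`. -/
def xMinus (q lam : ℂ) : ℂ := (lam * q - (q * lam)⁻¹ - lam + lam⁻¹) / 2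

/-- The Lax operator at site `n`, a `2 × 2` matrix over the auxiliary space with operator
entries.  It is the six-vertex `R`-matrix acting on the auxiliary space and the `n`-th site. -/
def lax {N : ℕ} (q : ℂ) (n : Fin N) (lam : ℂ) : Matrix (Fin 2) (Fin 2) (Op N) :=
  !![siteOp n (xPlus q lam • (1 : Matrix (Fin 2) (Fin 2) ℂ) + xMinus q lam • sigmaZ),
      siteOp n ((q - q⁻¹) • sigmaMinus);
    siteOp n ((q - q⁻¹) • sigmaPlus),
      siteOp n (xPlus q lam • (1 : Matrix (Fin 2) (Fin 2) ℂ) - xMinus q lam • sigmaZ)]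

/-- The inhomogeneous monodromy matrix `L_N(lam/η_N) ⋯ L_1(lam/η_1)`. -/
def monodromy {N : ℕ} (q : ℂ) (η : Fin N → ℂ) (lam : ℂ) : Matrix (Fin 2) (Fin 2) (Op N) :=
  (List.ofFn fun n : Fin N => lax q n (lam / η n)).reverse.prod

/-- The Yang-Baxter generator `B(lam)`. -/
def opB {N : ℕ} (q : ℂ) (η : Fin N → ℂ) (lam : ℂ) : Op N := monodromy q η lam 0 1

/-- The Yang-Baxter generator `C(lam)`. -/
def opC {N : ℕ} (q : ℂ) (η : Fin N → ℂ) (lam : ℂ) : Op N := monodromy q η lam 1 0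

/-- `a(lam) = - ∏ₙ (lam q / ηₙ - ηₙ / (lam q))`. -/
def coeffA {N : ℕ} (q : ℂ) (η : Fin N → ℂ) (lam : ℂ) : ℂ :=
  -∏ n : Fin N, (lam * q / η n - η n / (lam * q))

/-- `d(lam) = ∏ₙ (lam / ηₙ - ηₙ / lam)`. -/
def coeffD {N : ℕ} (η : Fin N → ℂ) (lam : ℂ) : ℂ :=
  ∏ n : Fin N, (lam / η n - η n / lam)

/-- The coordinates of both reference states `⟨0|` and `|0⟩` (all spins up). -/
def reference (N : ℕ) : Config N → ℂ := Pi.single 0 1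

/-- The product `∏_{b < a} r a b` over pairs of sites. -/
def pairProd {N : ℕ} (r : Fin N → Fin N → ℂ) : ℂ :=
  ∏ a : Fin N, ∏ b ∈ Finset.univ.filter (fun b : Fin N => b < a), r a b

/-- The left state `⟨h_1,…,h_N| = (1/n) ⟨0| ∏ₙ (C(ηₙ) / d(ηₙ/q)) ^ hₙ`, where the
normalization is `n = ∏_{b<a} r a b`. -/
def leftSOV {N : ℕ} (q : ℂ) (η : Fin N → ℂ) (r : Fin N → Fin N → ℂ) (h : Config N) : Bra N :=
  (1 / pairProd r) • (reference N ᵥ*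
    (List.ofFn fun n : Fin N =>
      ((1 / coeffD η (η n / q)) • opC q η (η n)) ^ (h n : ℕ)).prod)

/-- The right state `|h_1,…,h_N⟩ = (1/n) ∏ₙ (B(ηₙ) / a(ηₙ)) ^ hₙ |0⟩`, where the
normalization is `n = ∏_{b<a} r a b`. -/
def rightSOV {N : ℕ} (q : ℂ) (η : Fin N → ℂ) (r : Fin N → Fin N → ℂ) (h : Config N) : Ket N :=
  (1 / pairProd r) • (
    (List.ofFn fun n : Fin N =>
      ((1 / coeffA q η (η n)) • opB q η (η n)) ^ (h n : ℕ)).prod *ᵥ reference N)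

/-- The point `ηₐ q^(-h)`. -/
def pt {N : ℕ} (q : ℂ) (η : Fin N → ℂ) (a : Fin N) (h : Fin 2) : ℂ :=
  η a * q ^ (-((h : ℕ) : ℤ))

/-- `ω(x) = x ^ (N - 1)`. -/
def omega (N : ℕ) (x : ℂ) : ℂ := x ^ ((N : ℤ) - 1)

/-- The coefficient `∏ₐ f_a(ηₐ q^(-hₐ)) / ω(ηₐ q^(-hₐ)) ∏_{b<a} (ηₐ² q^(-2hₐ) - η_b² q^(-2h_b))`
of a separate state on the state labelled by `h`. -/
def sepCoeff {N : ℕ} (q : ℂ) (η : Fin N → ℂ) (f : Fin N → ℂ → ℂ) (h : Config N) : ℂ :=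
  (∏ a : Fin N, f a (pt q η a (h a)) / omega N (pt q η a (h a))) *
    pairProd (fun a b => pt q η a (h a) ^ 2 - pt q η b (h b) ^ 2)

/-- The left separate state `⟨α|`. -/
def leftSeparate {N : ℕ} (q : ℂ) (η : Fin N → ℂ) (r : Fin N → Fin N → ℂ)
    (α : Fin N → ℂ → ℂ) : Bra N :=
  ∑ h : Config N, sepCoeff q η α h • leftSOV q η r h

/-- The right separate state `|β⟩`. -/
def rightSeparate {N : ℕ} (q : ℂ) (η : Fin N → ℂ) (r : Fin N → Fin N → ℂ)
    (β : Fin N → ℂ → ℂ) : Ket N :=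
  ∑ h : Config N, sepCoeff q η β h • rightSOV q η r h

/-- The `N × N` matrix `M_{a,b} = ηₐ^(2(b-1)) ∑_{h=0,1} α_a β_a(ηₐ q^(-h)) q^(-2(b-1)h) / ω`.
Indices start at `0` here: the `b - 1` of indices starting at `1` is `(b : ℕ)`. -/
def pairingMatrix {N : ℕ} (q : ℂ) (η : Fin N → ℂ) (α β : Fin N → ℂ → ℂ) :
    Matrix (Fin N) (Fin N) ℂ :=
  Matrix.of fun a b => η a ^ (2 * (b : ℕ)) *
    ∑ h : Fin 2, α a (pt q η a h) * β a (pt q η a h) / omega N (pt q η a h) *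
      q ^ (-(2 * ((b : ℕ) : ℤ) * ((h : ℕ) : ℤ)))

end SixVertex

end

/-! The proof is the separation-of-variables argument for `D(λ)`. The RTT relation for the monodromy
matrix makes the `B(η_n)` commute with one another, and likewise the `C(η_n)`. It also exchanges
`D(λ)` with `B(μ)` or `C(μ)` up to one unwanted term, which carries `D(μ)`. At `μ = η_n` that term
vanishes on any state where site `n` has not been acted on, so every SoV bra and ket is an
eigenvector of `D(λ)`, with eigenvalue `∏ (q^(h_m) λ/η_m - inverse)`. At `λ = η_n/q` this eigenvalue
vanishes exactly when `h_n = 1`; hence states with different labels are orthogonal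
(`braState_dotProduct_ketState_of_ne`).

The diagonal pairings come from induction on the length of the chain
(`braState_dotProduct_ketState_self`). States are split by the spin of the last site: for `h_N = 0`
the ket has only an up component, for `h_N = 1` the bra has only a down component. One component
therefore contributes, and it is an explicit multiple of the pairing on the shorter chain. After
normalization, the pairing times the Vandermonde product in the squared shifted points is `∏ ω`
(`leftSOV_dotProduct_rightSOV_self`).

The double sum over labels thus collapses to a single one, and the pairing cancels one of the two
Vandermonde products and one of the two factors `∏ ω⁻¹`. What is left is the expansion, multilinear
in the rows, of a determinant whose row `a` is a sum of two Vandermonde rows (`det_pairingMatrix`).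
-/

noncomputable section

namespace SixVertex

/-- The multiplicative analogue `x - x⁻¹` of `2 sinh`. -/
def bracket (x : ℂ) : ℂ := x - x⁻¹

/-! ### The RTT relation over an arbitrary algebra -/

section RTT

variable {𝒜 ℬ : Type*} [Ring 𝒜] [Ring ℬ]

/-- `X ⊗ 1` on the product of two auxiliary spaces. -/
def leftAux (X : Matrix (Fin 2) (Fin 2) 𝒜) : Matrix (Fin 2 × Fin 2) (Fin 2 × Fin 2) 𝒜 :=
  Matrix.of fun p s => if p.2 = s.2 then X p.1 s.1 else 0

/-- `1 ⊗ Y` on the product of two auxiliary spaces. -/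
def rightAux (Y : Matrix (Fin 2) (Fin 2) 𝒜) : Matrix (Fin 2 × Fin 2) (Fin 2 × Fin 2) 𝒜 :=
  Matrix.of fun p s => if p.1 = s.1 then Y p.2 s.2 else 0

/-- The six-vertex `R`-matrix at multiplicative spectral parameter `x`. -/
def rMatrix (q x : ℂ) : Matrix (Fin 2 × Fin 2) (Fin 2 × Fin 2) ℂ :=
  Matrix.of fun p s =>
    if p = s then (if p.1 = p.2 then bracket (q * x) else bracket x)
    else if p = s.swap then bracket q else 0

theorem leftAux_mul (X X' : Matrix (Fin 2) (Fin 2) 𝒜) :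
    leftAux (X * X') = leftAux X * leftAux X' := by
  ext ⟨i, j⟩ ⟨k, l⟩
  fin_cases j <;> fin_cases l <;>
    simp [leftAux, Matrix.mul_apply, Fintype.sum_prod_type]

theorem rightAux_mul (X X' : Matrix (Fin 2) (Fin 2) 𝒜) :
    rightAux (X * X') = rightAux X * rightAux X' := by
  ext ⟨i, j⟩ ⟨k, l⟩
  fin_cases i <;> fin_cases k <;>
    simp [rightAux, Matrix.mul_apply, Fintype.sum_prod_type]

theorem leftAux_one : leftAux (1 : Matrix (Fin 2) (Fin 2) 𝒜) = 1 := by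
  ext ⟨i, j⟩ ⟨k, l⟩
  simp only [leftAux, Matrix.of_apply, Matrix.one_apply, Prod.mk.injEq]
  split_ifs <;> simp_all

theorem rightAux_one : rightAux (1 : Matrix (Fin 2) (Fin 2) 𝒜) = 1 := by
  ext ⟨i, j⟩ ⟨k, l⟩
  simp only [rightAux, Matrix.of_apply, Matrix.one_apply, Prod.mk.injEq]
  split_ifs <;> simp_all

/-- The entries lie in a noncommutative ring, so acting on different auxiliary spaces is not enough:
the quantum entries must commute as well. -/
theorem leftAux_mul_rightAux_comm {X Y : Matrix (Fin 2) (Fin 2) 𝒜}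
    (h : ∀ i j k l, Commute (X i j) (Y k l)) :
    leftAux X * rightAux Y = rightAux Y * leftAux X := by
  ext ⟨i, j⟩ ⟨k, l⟩
  simp only [leftAux, rightAux, Matrix.mul_apply, Fintype.sum_prod_type, Matrix.of_apply,
    ite_mul, mul_ite, zero_mul, mul_zero, Finset.sum_ite_eq, Finset.sum_ite_eq',
    Finset.mem_univ, if_true, Finset.sum_comm]
  simp [(h _ _ _ _).eq]

variable [Algebra ℂ 𝒜] [Algebra ℂ ℬ]

/-- The relation `R (X ⊗ 1) (1 ⊗ Y) = (1 ⊗ Y) (X ⊗ 1) R`. -/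
def Intertwines (q x : ℂ) (X Y : Matrix (Fin 2) (Fin 2) 𝒜) : Prop :=
  (rMatrix q x).map (algebraMap ℂ 𝒜) * (leftAux X * rightAux Y) =
    rightAux Y * leftAux X * (rMatrix q x).map (algebraMap ℂ 𝒜)

theorem Intertwines.one (q x : ℂ) : Intertwines (𝒜 := 𝒜) q x 1 1 := by
  simp [Intertwines, leftAux_one, rightAux_one]

/-- Train argument: factors belonging to different sites slide past each other, so `R` is carried
through one site at a time. -/
theorem Intertwines.mul {q x : ℂ} {X Y X' Y' : Matrix (Fin 2) (Fin 2) 𝒜}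
    (h : Intertwines q x X Y) (h' : Intertwines q x X' Y')
    (hXY : ∀ i j k l, Commute (X i j) (Y' k l)) (hYX : ∀ i j k l, Commute (X' i j) (Y k l)) :
    Intertwines q x (X * X') (Y * Y') := by
  have e1 := leftAux_mul_rightAux_comm hXY
  have e2 := leftAux_mul_rightAux_comm hYX
  unfold Intertwines at *
  rw [leftAux_mul, rightAux_mul]
  calc _ = (rMatrix q x).map (algebraMap ℂ 𝒜) *
        (leftAux X * (leftAux X' * rightAux Y) * rightAux Y') := by simp only [mul_assoc]
    _ = ((rMatrix q x).map (algebraMap ℂ 𝒜) * (leftAux X * rightAux Y)) *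
        (leftAux X' * rightAux Y') := by rw [e2]; simp only [mul_assoc]
    _ = rightAux Y * leftAux X * ((rMatrix q x).map (algebraMap ℂ 𝒜) *
        (leftAux X' * rightAux Y')) := by rw [h]; simp only [mul_assoc]
    _ = rightAux Y * (leftAux X * rightAux Y') * leftAux X' *
        (rMatrix q x).map (algebraMap ℂ 𝒜) := by rw [h']; simp only [mul_assoc]
    _ = _ := by rw [e1]; simp only [mul_assoc]

theorem Intertwines.map {q x : ℂ} {X Y : Matrix (Fin 2) (Fin 2) 𝒜}
    (h : Intertwines q x X Y) (φ : 𝒜 →ₐ[ℂ] ℬ) : Intertwines q x (X.map φ) (Y.map φ) := by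
  have hl : ∀ Z : Matrix (Fin 2) (Fin 2) 𝒜, (leftAux Z).map φ = leftAux (Z.map φ) := by
    intro Z; ext p s; simp only [leftAux, Matrix.map_apply, Matrix.of_apply]; split_ifs <;> simp
  have hr : ∀ Z : Matrix (Fin 2) (Fin 2) 𝒜, (rightAux Z).map φ = rightAux (Z.map φ) := by
    intro Z; ext p s; simp only [rightAux, Matrix.map_apply, Matrix.of_apply]; split_ifs <;> simp
  have hR : ((rMatrix q x).map (algebraMap ℂ 𝒜)).map φ = (rMatrix q x).map (algebraMap ℂ ℬ) := by
    ext p s; simp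
  have := congrArg (fun Z => Z.map φ) h
  simpa only [Intertwines, Matrix.map_mul, hl, hr, hR] using this

theorem intertwines_iff {q x : ℂ} {X Y : Matrix (Fin 2) (Fin 2) 𝒜} :
    Intertwines q x X Y ↔ ∀ i j k l : Fin 2,
      (∑ p : Fin 2 × Fin 2, rMatrix q x (i, j) p • (X p.1 k * Y p.2 l)) =
        ∑ p : Fin 2 × Fin 2, rMatrix q x p (k, l) • (Y j p.2 * X i p.1) := by
  have e1 : ∀ p s : Fin 2 × Fin 2,
      (leftAux X * rightAux Y) p s = X p.1 s.1 * Y p.2 s.2 := by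
    intro p s
    simp [leftAux, rightAux, Matrix.mul_apply, Fintype.sum_prod_type, ite_mul, mul_ite]
  have e2 : ∀ p s : Fin 2 × Fin 2,
      (rightAux Y * leftAux X) p s = Y p.2 s.2 * X p.1 s.1 := by
    intro p s
    simp [leftAux, rightAux, Matrix.mul_apply, Fintype.sum_prod_type, ite_mul, mul_ite]
  unfold Intertwines
  rw [← Matrix.ext_iff]
  simp only [Prod.forall, Matrix.mul_apply (M := (rMatrix q x).map _),
    Matrix.mul_apply (N := (rMatrix q x).map _), e1, e2, Matrix.map_apply, ← Algebra.smul_def,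
    ← Algebra.commutes]

/-- The exchange relations of an intertwined pair used for separation of variables. -/
theorem Intertwines.relations {q x : ℂ} {X Y : Matrix (Fin 2) (Fin 2) 𝒜}
    (h : Intertwines q x X Y) :
    bracket (q * x) • (X 0 1 * Y 0 1) = bracket (q * x) • (Y 0 1 * X 0 1) ∧
    bracket (q * x) • (X 1 0 * Y 1 0) = bracket (q * x) • (Y 1 0 * X 1 0) ∧
    bracket x • (X 1 1 * Y 0 1) + bracket q • (X 0 1 * Y 1 1) =
      bracket (q * x) • (Y 0 1 * X 1 1) ∧
    bracket (q * x) • (X 1 1 * Y 1 0) =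
      bracket x • (Y 1 0 * X 1 1) + bracket q • (Y 1 1 * X 1 0) := by
  rw [intertwines_iff] at h
  -- Component `(i,j),(k,l)` contains `X i k * Y j l`; this dictates the indices chosen below.
  refine ⟨?_, ?_, ?_, ?_⟩
  · simpa [rMatrix, Fintype.sum_prod_type] using h 0 0 1 1
  · simpa [rMatrix, Fintype.sum_prod_type] using h 1 1 0 0
  · simpa [rMatrix, Fintype.sum_prod_type, add_comm] using h 1 0 1 1
  · simpa [rMatrix, Fintype.sum_prod_type, add_comm] using h 1 1 1 0

end RTT

/-! ### The local Lax matrix -/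

/-- The Lax matrix, over the algebra of `2 × 2` matrices of a single site. -/
def localLax (q lam : ℂ) : Matrix (Fin 2) (Fin 2) (Matrix (Fin 2) (Fin 2) ℂ) :=
  !![xPlus q lam • (1 : Matrix (Fin 2) (Fin 2) ℂ) + xMinus q lam • sigmaZ,
      (q - q⁻¹) • sigmaMinus;
    (q - q⁻¹) • sigmaPlus,
      xPlus q lam • (1 : Matrix (Fin 2) (Fin 2) ℂ) - xMinus q lam • sigmaZ]

theorem localLax_eq (q lam : ℂ) : localLax q lam =
    !![!![bracket (q * lam), 0; 0, bracket lam], !![0, 0; bracket q, 0];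
       !![0, bracket q; 0, 0], !![bracket lam, 0; 0, bracket (q * lam)]] := by
  ext i j k l
  fin_cases i <;> fin_cases j <;> fin_cases k <;> fin_cases l <;>
    simp [localLax, bracket, xPlus, xMinus, sigmaZ, sigmaPlus, sigmaMinus] <;> ring

/-- This is the Yang-Baxter equation for the six-vertex `R`-matrix, with the site as third space,
verified entry by entry. -/
theorem intertwines_localLax {q lam mu : ℂ} (hq : q ≠ 0) (hl : lam ≠ 0) (hm : mu ≠ 0) :
    Intertwines q (lam / mu) (localLax q lam) (localLax q mu) := by
  rw [intertwines_iff, localLax_eq, localLax_eq]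
  intro i j k l
  fin_cases i <;> fin_cases j <;> fin_cases k <;> fin_cases l <;>
    simp [rMatrix, Fintype.sum_prod_type, -mul_eq_mul_left_iff, -mul_eq_mul_right_iff] <;>
    simp only [bracket] <;> (try field_simp) <;> (try refine ⟨?_, ?_⟩) <;>
    first | trivial | ring1 | (ext t; fin_cases t <;> rfl)

/-! ### Adding a last site to the chain, and RTT for the monodromy -/

section Chain

variable {N : ℕ}

/-- Append the state of a new last site. -/
def append (h : Config N) (s : Fin 2) : Config (N + 1) := Fin.snoc (α := fun _ => Fin 2) h s

@[simp] theorem append_last (h : Config N) (s : Fin 2) : append h s (Fin.last N) = s := by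
  simp [append]

@[simp] theorem append_castSucc (h : Config N) (s : Fin 2) (n : Fin N) :
    append h s n.castSucc = h n := by
  simp [append]

theorem append_init (h : Config (N + 1)) :
    append (fun n => h n.castSucc) (h (Fin.last N)) = h :=
  Fin.snoc_init_self (α := fun _ => Fin 2) h

theorem sum_config (f : Config (N + 1) → ℂ) :
    ∑ h, f h = ∑ s, ∑ h, f (append h s) := by
  rw [← (Fin.snocEquiv (fun _ : Fin (N + 1) => Fin 2)).sum_comp f, Fintype.sum_prod_type]
  rfl

theorem append_inj {h k : Config N} {s t : Fin 2} :
    append h s = append k t ↔ h = k ∧ s = t := by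
  refine ⟨fun e => ⟨funext fun n => ?_, ?_⟩, fun e => by rw [e.1, e.2]⟩
  · simpa using congrFun e n.castSucc
  · simpa using congrFun e (Fin.last N)

theorem op_ext {A B : Op (N + 1)}
    (H : ∀ h s k t, A (append h s) (append k t) = B (append h s) (append k t)) : A = B := by
  ext h k
  simpa only [append_init] using H (fun n => h n.castSucc) (h (Fin.last N))
    (fun n => k n.castSucc) (k (Fin.last N))

/-- The operator `M ⊗ s`, with `s` acting on the new last site. -/
def tensorOp (M : Op N) (s : Matrix (Fin 2) (Fin 2) ℂ) : Op (N + 1) :=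
  Matrix.of fun h k => M (fun n => h n.castSucc) (fun n => k n.castSucc) *
    s (h (Fin.last N)) (k (Fin.last N))

theorem tensorOp_apply (M : Op N) (x : Matrix (Fin 2) (Fin 2) ℂ) (h k : Config N)
    (s t : Fin 2) : tensorOp M x (append h s) (append k t) = M h k * x s t := by
  simp [tensorOp]

theorem tensorOp_one_one : tensorOp (1 : Op N) 1 = 1 :=
  op_ext fun h s k t => by
    simp only [tensorOp_apply, Matrix.one_apply, append_inj]
    split_ifs <;> simp_all

theorem tensorOp_mul (A B : Op N) (x y : Matrix (Fin 2) (Fin 2) ℂ) :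
    tensorOp (A * B) (x * y) = tensorOp A x * tensorOp B y :=
  op_ext fun h s k t => by
    simp only [tensorOp_apply, Matrix.mul_apply, sum_config, Finset.sum_mul_sum]
    rw [Finset.sum_comm]
    exact Finset.sum_congr rfl fun _ _ => Finset.sum_congr rfl fun _ _ => by ring

/-- `M ⊗ 1`, with a new last site on which nothing acts. -/
def initEmb (N : ℕ) : Op N →ₐ[ℂ] Op (N + 1) :=
  AlgHom.ofLinearMap
    { toFun := fun M => tensorOp M 1
      map_add' := fun A B => by ext; simp [tensorOp, add_mul]
      map_smul' := fun c A => by ext; simp [tensorOp, mul_assoc] }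
    tensorOp_one_one
    fun A B => by simpa using tensorOp_mul A B 1 1

/-- `1 ⊗ s`, with `s` acting on the last site. -/
def lastEmb (N : ℕ) : Matrix (Fin 2) (Fin 2) ℂ →ₐ[ℂ] Op (N + 1) :=
  AlgHom.ofLinearMap
    { toFun := fun s => tensorOp 1 s
      map_add' := fun A B => by ext; simp [tensorOp, mul_add]
      map_smul' := fun c A => by ext; simp [tensorOp, mul_left_comm] }
    tensorOp_one_one
    fun x y => by simpa using tensorOp_mul (1 : Op N) 1 x y

theorem initEmb_apply (M : Op N) (h k : Config N) (s t : Fin 2) :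
    initEmb N M (append h s) (append k t) = if s = t then M h k else 0 := by
  simp [initEmb, tensorOp_apply, Matrix.one_apply]

theorem lastEmb_apply (M : Matrix (Fin 2) (Fin 2) ℂ) (h k : Config N) (s t : Fin 2) :
    lastEmb N M (append h s) (append k t) = if h = k then M s t else 0 := by
  simp [lastEmb, tensorOp_apply, Matrix.one_apply]

theorem commute_lastEmb_initEmb (A : Matrix (Fin 2) (Fin 2) ℂ) (B : Op N) :
    Commute (lastEmb N A) (initEmb N B) := by
  refine op_ext fun h s k t => ?_
  simp [Matrix.mul_apply, sum_config, initEmb_apply, lastEmb_apply, mul_comm]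

theorem siteOp_last (s : Matrix (Fin 2) (Fin 2) ℂ) : siteOp (Fin.last N) s = lastEmb N s := by
  refine op_ext fun h a k b => ?_
  simp only [siteOp, lastEmb_apply, Matrix.of_apply, Fin.prod_univ_castSucc, append_last,
    append_castSucc, if_true, Fin.castSucc_ne_last, if_false, Matrix.one_apply]
  by_cases hk : h = k
  · simp [hk]
  · obtain ⟨n, hn⟩ := Function.ne_iff.mp hk
    rw [Finset.prod_eq_zero (Finset.mem_univ n) (by simp [hn])]
    simp [hk]

theorem siteOp_castSucc (n : Fin N) (s : Matrix (Fin 2) (Fin 2) ℂ) :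
    siteOp n.castSucc s = initEmb N (siteOp n s) := by
  refine op_ext fun h a k b => ?_
  simp [siteOp, initEmb_apply, Fin.prod_univ_castSucc, (Fin.castSucc_ne_last n).symm,
    Matrix.one_apply]

theorem lax_last (q lam : ℂ) : lax q (Fin.last N) lam = (localLax q lam).map (lastEmb N) := by
  ext1 i j
  fin_cases i <;> fin_cases j <;> simp only [lax, localLax, siteOp_last] <;> rfl

theorem lax_castSucc (q lam : ℂ) (n : Fin N) :
    lax q n.castSucc lam = (lax q n lam).map (initEmb N) := by
  ext1 i j
  fin_cases i <;> fin_cases j <;> simp only [lax, siteOp_castSucc] <;> rfl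

theorem monodromy_zero (q : ℂ) (η : Fin 0 → ℂ) (lam : ℂ) : monodromy q η lam = 1 := by
  simp [monodromy]

theorem monodromy_succ (q : ℂ) (η : Fin (N + 1) → ℂ) (lam : ℂ) :
    monodromy q η lam = (localLax q (lam / η (Fin.last N))).map (lastEmb N) *
      (monodromy q (fun n : Fin N => η n.castSucc) lam).map (initEmb N) := by
  have e : ∀ l : List (Matrix (Fin 2) (Fin 2) (Op N)),
      (l.prod).map (initEmb N) = (l.map fun M => M.map (initEmb N)).prod := by
    intro l
    exact map_list_prod (AlgHom.mapMatrix (m := Fin 2) (initEmb N)) l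
  rw [monodromy, List.ofFn_succ', List.concat_eq_append, List.reverse_append]
  simp only [List.reverse_cons, List.reverse_nil, List.nil_append, List.singleton_append,
    List.prod_cons, monodromy, e, List.map_reverse, List.map_ofFn, lax_last, lax_castSucc]
  rfl

theorem intertwines_monodromy {q lam mu : ℂ} (hq : q ≠ 0) (hl : lam ≠ 0) (hm : mu ≠ 0) :
    ∀ {N : ℕ} (η : Fin N → ℂ), (∀ n, η n ≠ 0) →
      Intertwines q (lam / mu) (monodromy q η lam) (monodromy q η mu)
  | 0, η, _ => by simpa [monodromy_zero] using Intertwines.one q (lam / mu)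
  | N + 1, η, hη => by
    rw [monodromy_succ, monodromy_succ]
    refine Intertwines.mul ?_
      ((intertwines_monodromy hq hl hm (fun n => η n.castSucc) fun n => hη _).map _)
      (fun i j k l => commute_lastEmb_initEmb _ _)
      (fun i j k l => (commute_lastEmb_initEmb _ _).symm)
    have := intertwines_localLax hq (div_ne_zero hl (hη (Fin.last N)))
      (div_ne_zero hm (hη (Fin.last N)))
    -- `R` depends only on the ratio of spectral parameters, so the inhomogeneity drops out and all
    -- sites share one `R`.
    rw [div_div_div_cancel_right₀ (hη _)] at this
    exact this.map _

end Chain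

/-! ### Brackets and genericity -/

theorem bracket_one : bracket 1 = 0 := by simp [bracket]

theorem bracket_inv (x : ℂ) : bracket x⁻¹ = -bracket x := by simp [bracket]

theorem bracket_eq_zero_iff {x : ℂ} (hx : x ≠ 0) : bracket x = 0 ↔ x ^ 2 = 1 := by
  rw [bracket, sub_eq_zero, sq, mul_eq_one_iff_eq_inv₀ hx]

/-- Genericity of the inhomogeneities, in terms of `bracket`. -/
structure Separated {N : ℕ} (q : ℂ) (η : Fin N → ℂ) : Prop where
  q_ne : q ≠ 0
  ne : ∀ n, η n ≠ 0
  bracket_q : bracket q ≠ 0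
  bracket_div : ∀ n m, n ≠ m → bracket (η n / η m) ≠ 0
  bracket_mul_div : ∀ n m, n ≠ m → bracket (q * (η n / η m)) ≠ 0

theorem Separated.init {N : ℕ} {q : ℂ} {η : Fin (N + 1) → ℂ} (hs : Separated q η) :
    Separated q (fun n : Fin N => η n.castSucc) where
  q_ne := hs.q_ne
  ne n := hs.ne _
  bracket_q := hs.bracket_q
  bracket_div n m h := hs.bracket_div _ _ (by simpa using h)
  bracket_mul_div n m h := hs.bracket_mul_div _ _ (by simpa using h)

/-! ### Commutation and exchange relations at the inhomogeneities -/

section Exchange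

variable {N : ℕ} {q : ℂ} {η : Fin N → ℂ}

/-- The Yang-Baxter generator `A(lam)`. -/
def opA (q : ℂ) (η : Fin N → ℂ) (lam : ℂ) : Op N := monodromy q η lam 0 0

/-- The Yang-Baxter generator `D(lam)`. -/
def opD (q : ℂ) (η : Fin N → ℂ) (lam : ℂ) : Op N := monodromy q η lam 1 1

theorem Separated.commute_opB (hs : Separated q η) (n m : Fin N) :
    Commute (opB q η (η n)) (opB q η (η m)) := by
  rcases eq_or_ne n m with rfl | h
  · exact Commute.refl _
  · exact smul_right_injective _ (hs.bracket_mul_div n m h)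
      (intertwines_monodromy hs.q_ne (hs.ne n) (hs.ne m) η hs.ne).relations.1

theorem Separated.commute_opC (hs : Separated q η) (n m : Fin N) :
    Commute (opC q η (η n)) (opC q η (η m)) := by
  rcases eq_or_ne n m with rfl | h
  · exact Commute.refl _
  · exact smul_right_injective _ (hs.bracket_mul_div n m h)
      (intertwines_monodromy hs.q_ne (hs.ne n) (hs.ne m) η hs.ne).relations.2.1

/-- The unwanted term of the exchange relation is `B(lam) D(mu) v`, which `hv0` removes; `B(mu)`
then preserves eigenvectors of `D(lam)`. -/
theorem opD_mulVec_opB (hq : q ≠ 0) (hη : ∀ n, η n ≠ 0) {lam mu : ℂ} (hl : lam ≠ 0)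
    (hm : mu ≠ 0) (hb : bracket (lam / mu) ≠ 0) {v : Ket N} {e : ℂ}
    (hv : opD q η lam *ᵥ v = e • v) (hv0 : opD q η mu *ᵥ v = 0) :
    opD q η lam *ᵥ (opB q η mu *ᵥ v) =
      (bracket (q * (lam / mu)) / bracket (lam / mu) * e) • (opB q η mu *ᵥ v) := by
  have h := (intertwines_monodromy hq hl hm η hη).relations.2.2.1
  have h' := congrArg (· *ᵥ v) h
  simp only [Matrix.add_mulVec, Matrix.smul_mulVec, ← Matrix.mulVec_mulVec] at h'
  change _ • (opD q η lam *ᵥ (opB q η mu *ᵥ v)) + _ • (opB q η lam *ᵥ (opD q η mu *ᵥ v)) =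
    _ • (opB q η mu *ᵥ (opD q η lam *ᵥ v)) at h'
  rw [hv, hv0, Matrix.mulVec_zero, smul_zero, add_zero, Matrix.mulVec_smul] at h'
  apply smul_right_injective _ hb
  simp only
  rw [h', smul_smul, smul_smul]
  congr 1
  field_simp

theorem opC_vecMul_opD (hq : q ≠ 0) (hη : ∀ n, η n ≠ 0) {lam mu : ℂ} (hl : lam ≠ 0)
    (hm : mu ≠ 0) (hb : bracket (lam / mu) ≠ 0) {u : Bra N} {e : ℂ}
    (hu : u ᵥ* opD q η lam = e • u) (hu0 : u ᵥ* opD q η mu = 0) :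
    (u ᵥ* opC q η mu) ᵥ* opD q η lam =
      (bracket (q * (lam / mu)) / bracket (lam / mu) * e) • (u ᵥ* opC q η mu) := by
  have h := (intertwines_monodromy hq hl hm η hη).relations.2.2.2
  have h' := congrArg (u ᵥ* ·) h
  simp only [Matrix.vecMul_add, Matrix.vecMul_smul, ← Matrix.vecMul_vecMul] at h'
  change _ • ((u ᵥ* opD q η lam) ᵥ* opC q η mu) = _ • ((u ᵥ* opC q η mu) ᵥ* opD q η lam) +
    _ • ((u ᵥ* opD q η mu) ᵥ* opC q η lam) at h'
  rw [hu, hu0, Matrix.zero_vecMul, smul_zero, add_zero, Matrix.smul_vecMul] at h'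
  apply smul_right_injective _ hb
  simp only
  rw [← h', smul_smul, smul_smul]
  congr 1
  field_simp

end Exchange

/-! ### Action of the generators on the last-site components -/

section Slices

variable {N : ℕ}

/-- The component of a vector along a given state of the last site. -/
def slice (v : Config (N + 1) → ℂ) (s : Fin 2) : Config N → ℂ := fun h => v (append h s)

theorem slice_add (u v : Config (N + 1) → ℂ) (s : Fin 2) :
    slice (u + v) s = slice u s + slice v s := rfl

theorem slice_smul (c : ℂ) (v : Config (N + 1) → ℂ) (s : Fin 2) :
    slice (c • v) s = c • slice v s := rfl

theorem slice_ext {u v : Config (N + 1) → ℂ} (h0 : slice u 0 = slice v 0)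
    (h1 : slice u 1 = slice v 1) : u = v := by
  ext h
  rw [← append_init h]
  generalize h (Fin.last N) = s
  fin_cases s
  exacts [congrFun h0 _, congrFun h1 _]

theorem dotProduct_slice (u v : Config (N + 1) → ℂ) :
    u ⬝ᵥ v = slice u 0 ⬝ᵥ slice v 0 + slice u 1 ⬝ᵥ slice v 1 := by
  simp [dotProduct, sum_config, slice]

theorem slice_initEmb_mulVec (M : Op N) (v : Config (N + 1) → ℂ) (s : Fin 2) :
    slice (initEmb N M *ᵥ v) s = M *ᵥ slice v s := by
  ext h
  simp [slice, Matrix.mulVec, dotProduct, sum_config, initEmb_apply, -Fin.sum_univ_two]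

theorem slice_lastEmb_mulVec (x : Matrix (Fin 2) (Fin 2) ℂ) (v : Config (N + 1) → ℂ)
    (s : Fin 2) : slice (lastEmb N x *ᵥ v) s = x s 0 • slice v 0 + x s 1 • slice v 1 := by
  ext h
  simp [slice, Matrix.mulVec, dotProduct, sum_config, lastEmb_apply]

theorem slice_vecMul_initEmb (M : Op N) (v : Config (N + 1) → ℂ) (s : Fin 2) :
    slice (v ᵥ* initEmb N M) s = slice v s ᵥ* M := by
  ext h
  simp only [slice, Matrix.vecMul, dotProduct, sum_config, initEmb_apply]
  rw [Finset.sum_comm]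
  simp [-Fin.sum_univ_two]

theorem slice_vecMul_lastEmb (x : Matrix (Fin 2) (Fin 2) ℂ) (v : Config (N + 1) → ℂ)
    (s : Fin 2) : slice (v ᵥ* lastEmb N x) s = x 0 s • slice v 0 + x 1 s • slice v 1 := by
  ext h
  simp [slice, Matrix.vecMul, dotProduct, sum_config, lastEmb_apply, mul_comm]

theorem monodromy_succ_apply (q : ℂ) (η : Fin (N + 1) → ℂ) (lam : ℂ) (i j : Fin 2) :
    monodromy q η lam i j =
      lastEmb N (localLax q (lam / η (Fin.last N)) i 0) *
          initEmb N (monodromy q (fun n => η n.castSucc) lam 0 j) +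
        lastEmb N (localLax q (lam / η (Fin.last N)) i 1) *
          initEmb N (monodromy q (fun n => η n.castSucc) lam 1 j) := by
  simp [monodromy_succ, Matrix.mul_apply]

variable (q : ℂ) (η : Fin (N + 1) → ℂ) (lam : ℂ) (v : Config (N + 1) → ℂ)

theorem slice_opB_mulVec_zero : slice (opB q η lam *ᵥ v) 0 =
    bracket (q * (lam / η (Fin.last N))) •
      (opB q (fun n => η n.castSucc) lam *ᵥ slice v 0) := by
  simp [opB, monodromy_succ_apply, Matrix.add_mulVec, ← Matrix.mulVec_mulVec, slice_add,
    slice_lastEmb_mulVec, slice_initEmb_mulVec, localLax_eq]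

theorem slice_opB_mulVec_one : slice (opB q η lam *ᵥ v) 1 =
    bracket (lam / η (Fin.last N)) •
      (opB q (fun n => η n.castSucc) lam *ᵥ slice v 1) +
    bracket q •
      (opD q (fun n => η n.castSucc) lam *ᵥ slice v 0) := by
  simp [opB, opD, monodromy_succ_apply, Matrix.add_mulVec, ← Matrix.mulVec_mulVec, slice_add,
    slice_lastEmb_mulVec, slice_initEmb_mulVec, localLax_eq]

theorem slice_opD_mulVec_zero : slice (opD q η lam *ᵥ v) 0 =
    bracket q •
      (opB q (fun n => η n.castSucc) lam *ᵥ slice v 1) +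
    bracket (lam / η (Fin.last N)) •
      (opD q (fun n => η n.castSucc) lam *ᵥ slice v 0) := by
  simp [opB, opD, monodromy_succ_apply, Matrix.add_mulVec, ← Matrix.mulVec_mulVec, slice_add,
    slice_lastEmb_mulVec, slice_initEmb_mulVec, localLax_eq]

theorem slice_opD_mulVec_one : slice (opD q η lam *ᵥ v) 1 =
    bracket (q * (lam / η (Fin.last N))) •
      (opD q (fun n => η n.castSucc) lam *ᵥ slice v 1) := by
  simp [opD, monodromy_succ_apply, Matrix.add_mulVec, ← Matrix.mulVec_mulVec, slice_add,
    slice_lastEmb_mulVec, slice_initEmb_mulVec, localLax_eq]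

theorem slice_vecMul_opA_zero : slice (v ᵥ* opA q η lam) 0 =
    bracket (q * (lam / η (Fin.last N))) •
      (slice v 0 ᵥ* opA q (fun n => η n.castSucc) lam) +
    bracket q •
      (slice v 1 ᵥ* opC q (fun n => η n.castSucc) lam) := by
  simp [opA, opC, monodromy_succ_apply, Matrix.vecMul_add, ← Matrix.vecMul_vecMul, slice_add,
    slice_vecMul_lastEmb, slice_vecMul_initEmb, Matrix.smul_vecMul, localLax_eq]

theorem slice_vecMul_opA_one : slice (v ᵥ* opA q η lam) 1 =
    bracket (lam / η (Fin.last N)) •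
      (slice v 1 ᵥ* opA q (fun n => η n.castSucc) lam) := by
  simp [opA, monodromy_succ_apply, Matrix.vecMul_add, ← Matrix.vecMul_vecMul, slice_add,
    slice_vecMul_lastEmb, slice_vecMul_initEmb, Matrix.smul_vecMul, localLax_eq]

theorem slice_vecMul_opB_zero : slice (v ᵥ* opB q η lam) 0 =
    bracket (q * (lam / η (Fin.last N))) •
      (slice v 0 ᵥ* opB q (fun n => η n.castSucc) lam) +
    bracket q •
      (slice v 1 ᵥ* opD q (fun n => η n.castSucc) lam) := by
  simp [opB, opD, monodromy_succ_apply, Matrix.vecMul_add, ← Matrix.vecMul_vecMul, slice_add,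
    slice_vecMul_lastEmb, slice_vecMul_initEmb, Matrix.smul_vecMul, localLax_eq]

theorem slice_vecMul_opB_one : slice (v ᵥ* opB q η lam) 1 =
    bracket (lam / η (Fin.last N)) •
      (slice v 1 ᵥ* opB q (fun n => η n.castSucc) lam) := by
  simp [opB, monodromy_succ_apply, Matrix.vecMul_add, ← Matrix.vecMul_vecMul, slice_add,
    slice_vecMul_lastEmb, slice_vecMul_initEmb, Matrix.smul_vecMul, localLax_eq]

theorem slice_vecMul_opC_zero : slice (v ᵥ* opC q η lam) 0 =
    bracket (lam / η (Fin.last N)) •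
      (slice v 0 ᵥ* opC q (fun n => η n.castSucc) lam) := by
  simp [opC, monodromy_succ_apply, Matrix.vecMul_add, ← Matrix.vecMul_vecMul, slice_add,
    slice_vecMul_lastEmb, slice_vecMul_initEmb, Matrix.smul_vecMul, localLax_eq]

theorem slice_vecMul_opC_one : slice (v ᵥ* opC q η lam) 1 =
    bracket q •
      (slice v 0 ᵥ* opA q (fun n => η n.castSucc) lam) +
    bracket (q * (lam / η (Fin.last N))) •
      (slice v 1 ᵥ* opC q (fun n => η n.castSucc) lam) := by
  simp [opA, opC, monodromy_succ_apply, Matrix.vecMul_add, ← Matrix.vecMul_vecMul, slice_add,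
    slice_vecMul_lastEmb, slice_vecMul_initEmb, Matrix.smul_vecMul, localLax_eq]

theorem slice_vecMul_opD_zero : slice (v ᵥ* opD q η lam) 0 =
    bracket (lam / η (Fin.last N)) •
      (slice v 0 ᵥ* opD q (fun n => η n.castSucc) lam) := by
  simp [opD, monodromy_succ_apply, Matrix.vecMul_add, ← Matrix.vecMul_vecMul, slice_add,
    slice_vecMul_lastEmb, slice_vecMul_initEmb, Matrix.smul_vecMul, localLax_eq]

theorem slice_vecMul_opD_one : slice (v ᵥ* opD q η lam) 1 =
    bracket q •
      (slice v 0 ᵥ* opB q (fun n => η n.castSucc) lam) +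
    bracket (q * (lam / η (Fin.last N))) •
      (slice v 1 ᵥ* opD q (fun n => η n.castSucc) lam) := by
  simp [opB, opD, monodromy_succ_apply, Matrix.vecMul_add, ← Matrix.vecMul_vecMul, slice_add,
    slice_vecMul_lastEmb, slice_vecMul_initEmb, Matrix.smul_vecMul, localLax_eq]

end Slices

/-! ### The reference state -/

section Reference

theorem slice_reference_zero (N : ℕ) : slice (reference (N + 1)) 0 = reference N := by
  have e : append (0 : Config N) 0 = 0 := by
    ext m; refine Fin.lastCases ?_ (fun m => ?_) m <;> simp
  ext h
  simp only [slice, reference, Pi.single_apply]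
  rw [← e]
  simp [append_inj]

theorem slice_reference_one (N : ℕ) : slice (reference (N + 1)) 1 = 0 := by
  have e : append (0 : Config N) 0 = 0 := by
    ext m; refine Fin.lastCases ?_ (fun m => ?_) m <;> simp
  ext h
  simp only [slice, reference, Pi.single_apply]
  rw [← e]
  simp [append_inj]

theorem opD_mulVec_reference (q lam : ℂ) : ∀ {N : ℕ} (η : Fin N → ℂ),
    opD q η lam *ᵥ reference N = (∏ m, bracket (lam / η m)) • reference N
  | 0, η => by simp [opD, monodromy_zero]
  | N + 1, η => by
    refine slice_ext ?_ ?_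
    · rw [slice_opD_mulVec_zero, slice_smul, slice_reference_zero, slice_reference_one,
        Matrix.mulVec_zero, smul_zero, zero_add, opD_mulVec_reference, smul_smul,
        Fin.prod_univ_castSucc, mul_comm]
    · simp [slice_opD_mulVec_one, slice_smul, slice_reference_one]

theorem reference_vecMul_opB (q lam : ℂ) : ∀ {N : ℕ} (η : Fin N → ℂ),
    reference N ᵥ* opB q η lam = 0
  | 0, η => by simp [opB, monodromy_zero]
  | N + 1, η => by
    refine slice_ext ?_ ?_
    · rw [slice_vecMul_opB_zero, slice_reference_zero, slice_reference_one,
        reference_vecMul_opB, Matrix.zero_vecMul, smul_zero, smul_zero, add_zero]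
      rfl
    · rw [slice_vecMul_opB_one, slice_reference_one, Matrix.zero_vecMul, smul_zero]
      rfl

theorem reference_vecMul_opD (q lam : ℂ) : ∀ {N : ℕ} (η : Fin N → ℂ),
    reference N ᵥ* opD q η lam = (∏ m, bracket (lam / η m)) • reference N
  | 0, η => by simp [opD, monodromy_zero]
  | N + 1, η => by
    refine slice_ext ?_ ?_
    · rw [slice_vecMul_opD_zero, slice_smul, slice_reference_zero, reference_vecMul_opD,
        smul_smul, Fin.prod_univ_castSucc, mul_comm]
    · rw [slice_vecMul_opD_one, slice_smul, slice_reference_zero, slice_reference_one,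
        reference_vecMul_opB, Matrix.zero_vecMul, smul_zero, smul_zero, smul_zero, add_zero]

theorem reference_vecMul_opA (q lam : ℂ) : ∀ {N : ℕ} (η : Fin N → ℂ),
    reference N ᵥ* opA q η lam = (∏ m, bracket (q * (lam / η m))) • reference N
  | 0, η => by simp [opA, monodromy_zero]
  | N + 1, η => by
    refine slice_ext ?_ ?_
    · rw [slice_vecMul_opA_zero, slice_smul, slice_reference_zero, slice_reference_one,
        reference_vecMul_opA, Matrix.zero_vecMul, smul_zero, add_zero,
        smul_smul, Fin.prod_univ_castSucc, mul_comm]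
    · rw [slice_vecMul_opA_one, slice_smul, slice_reference_one, Matrix.zero_vecMul,
        smul_zero, smul_zero]

end Reference

/-! ### Diagonalization of `D` and orthogonality -/

section Eigenvectors

variable {N : ℕ} {q : ℂ} {η : Fin N → ℂ}

/-- The eigenvalue of `D(lam)` on the separate states, `g` counting the shifts of the roots. -/
def eigenD (q : ℂ) (η : Fin N → ℂ) (g : Fin N → ℕ) (lam : ℂ) : ℂ :=
  ∏ m, bracket (q ^ g m * (lam / η m))

/-- An unshifted root remains at `η n`. This is what kills the unwanted terms. -/
theorem eigenD_eq_zero {g : Fin N → ℕ} {n : Fin N} (hn : η n ≠ 0) (hg : g n = 0) :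
    eigenD q η g (η n) = 0 :=
  Finset.prod_eq_zero (Finset.mem_univ n) (by simp [hg, div_self hn, bracket_one])

theorem eigenD_shift {g g' : Fin N → ℕ} {n : Fin N} {lam : ℂ} (hg : g n = 0) (hg' : g' n = 1)
    (hgg : ∀ m, m ≠ n → g' m = g m) (hb : bracket (lam / η n) ≠ 0) :
    bracket (q * (lam / η n)) / bracket (lam / η n) * eigenD q η g lam = eigenD q η g' lam := by
  rw [eigenD, eigenD, Fintype.prod_eq_mul_prod_compl n, Fintype.prod_eq_mul_prod_compl n (fun m =>
    bracket (q ^ g' m * (lam / η m))), hg, hg', pow_zero, pow_one, one_mul, ← mul_assoc,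
    div_mul_cancel₀ _ hb]
  refine congrArg _ (Finset.prod_congr rfl fun m hm => ?_)
  rw [hgg m (by simpa using hm)]

/-- The shifts of the roots after acting at the sites of `l`. -/
def shifts (l : List (Fin N)) (h : Config N) (m : Fin N) : ℕ := if m ∈ l then (h m : ℕ) else 0

theorem shifts_congr {l l' : List (Fin N)} {h : Config N}
    (H : ∀ m, h m = 1 → (m ∈ l ↔ m ∈ l')) : shifts l h = shifts l' h := by
  ext m
  have := H m
  rcases Fin.exists_fin_two.mp ⟨h m, rfl⟩ with e | e <;> simp_all [shifts]

theorem shifts_finRange (h : Config N) : shifts (List.finRange N) h = fun n => (h n : ℕ) := by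
  ext m; simp [shifts]

theorem opD_mulVec_list (hs : Separated q η) (h : Config N) (l : List (Fin N)) (hl : l.Nodup)
    {lam : ℂ} (hlam : lam ≠ 0) (hb : ∀ m ∈ l, h m = 1 → bracket (lam / η m) ≠ 0) :
    opD q η lam *ᵥ ((l.map fun n => opB q η (η n) ^ (h n : ℕ)).prod *ᵥ reference N) =
      eigenD q η (shifts l h) lam •
        ((l.map fun n => opB q η (η n) ^ (h n : ℕ)).prod *ᵥ reference N) := by
  induction l generalizing lam with
  | nil => simp [opD_mulVec_reference, eigenD, shifts]
  | cons n l ih =>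
    rw [List.nodup_cons] at hl
    -- The induction hypothesis is needed at two parameters: at `lam`, and at `η n` to annihilate
    -- the unwanted term. Hence `lam` is generalized.
    have ih' := @ih hl.2
    have hb' : ∀ m ∈ l, h m = 1 → bracket (lam / η m) ≠ 0 := fun m hm =>
      hb m (List.mem_cons_of_mem _ hm)
    rw [List.map_cons, List.prod_cons, ← Matrix.mulVec_mulVec]
    rcases Fin.exists_fin_two.mp ⟨h n, rfl⟩ with e | e
    · rw [e, Fin.val_zero, pow_zero, Matrix.one_mulVec, ih' hlam hb', shifts_congr]
      intro m hm
      have : m ≠ n := fun h => by simp_all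
      simp [this]
    · rw [e, Fin.val_one, pow_one, opD_mulVec_opB hs.q_ne hs.ne hlam (hs.ne n)
        (hb n List.mem_cons_self e) (ih' hlam hb'), eigenD_shift (g' := shifts (n :: l) h)]
      · simp [shifts, hl.1]
      · simp [shifts, e]
      · intro m hm; simp [shifts, hm]
      · exact hb n List.mem_cons_self e
      · rw [ih' (hs.ne n) fun m hm _ => hs.bracket_div n m fun e => hl.1 (e ▸ hm),
          eigenD_eq_zero (hs.ne n) (by simp [shifts, hl.1]), zero_smul]

theorem list_vecMul_opD (hs : Separated q η) (h : Config N) (l : List (Fin N)) (hl : l.Nodup)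
    {lam : ℂ} (hlam : lam ≠ 0) (hb : ∀ m ∈ l, h m = 1 → bracket (lam / η m) ≠ 0) :
    (reference N ᵥ* (l.map fun n => opC q η (η n) ^ (h n : ℕ)).prod) ᵥ* opD q η lam =
      eigenD q η (shifts l h) lam •
        (reference N ᵥ* (l.map fun n => opC q η (η n) ^ (h n : ℕ)).prod) := by
  -- On a bra the rightmost factor acts last, so the list is peeled from its end.
  induction l using List.reverseRecOn generalizing lam with
  | nil => simp [reference_vecMul_opD, eigenD, shifts]
  | append_singleton l n ih =>
    have hl' : n ∉ l ∧ l.Nodup := by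
      rw [List.nodup_append_comm] at hl; simpa using hl
    have ih' := @ih hl'.2
    have hb' : ∀ m ∈ l, h m = 1 → bracket (lam / η m) ≠ 0 := fun m hm =>
      hb m (by simp [hm])
    rw [List.map_append, List.prod_append, List.map_singleton, List.prod_singleton,
      ← Matrix.vecMul_vecMul]
    rcases Fin.exists_fin_two.mp ⟨h n, rfl⟩ with e | e
    · rw [e, Fin.val_zero, pow_zero, Matrix.vecMul_one, ih' hlam hb', shifts_congr]
      intro m hm
      have : m ≠ n := fun h => by simp_all
      simp [this]
    · rw [e, Fin.val_one, pow_one, opC_vecMul_opD hs.q_ne hs.ne hlam (hs.ne n)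
        (hb n (by simp) e) (ih' hlam hb'), eigenD_shift (g' := shifts (l ++ [n]) h)]
      · simp [shifts, hl'.1]
      · simp [shifts, e]
      · intro m hm; simp [shifts, hm]
      · exact hb n (by simp) e
      · rw [ih' (hs.ne n) fun m hm _ => hs.bracket_div n m fun e => hl'.1 (e ▸ hm),
          eigenD_eq_zero (hs.ne n) (by simp [shifts, hl'.1]), zero_smul]

/-- The product `B(η_1)^(h_1) ⋯ B(η_N)^(h_N)|0⟩`. -/
def ketState (q : ℂ) (η : Fin N → ℂ) (h : Config N) : Ket N :=
  (List.ofFn fun n => opB q η (η n) ^ (h n : ℕ)).prod *ᵥ reference N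

/-- The product `⟨0|C(η_1)^(h_1) ⋯ C(η_N)^(h_N)`. -/
def braState (q : ℂ) (η : Fin N → ℂ) (h : Config N) : Bra N :=
  reference N ᵥ* (List.ofFn fun n => opC q η (η n) ^ (h n : ℕ)).prod

theorem opD_mulVec_ketState (hs : Separated q η) (h : Config N) {lam : ℂ} (hlam : lam ≠ 0)
    (hb : ∀ m, h m = 1 → bracket (lam / η m) ≠ 0) :
    opD q η lam *ᵥ ketState q η h = eigenD q η (fun n => (h n : ℕ)) lam • ketState q η h := by
  simpa [← List.ofFn_eq_map, shifts_finRange, ketState] using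
    opD_mulVec_list hs h (List.finRange N) (List.nodup_finRange N) hlam fun m _ => hb m

theorem braState_vecMul_opD (hs : Separated q η) (h : Config N) {lam : ℂ} (hlam : lam ≠ 0)
    (hb : ∀ m, h m = 1 → bracket (lam / η m) ≠ 0) :
    braState q η h ᵥ* opD q η lam = eigenD q η (fun n => (h n : ℕ)) lam • braState q η h := by
  simpa [← List.ofFn_eq_map, shifts_finRange, braState] using
    list_vecMul_opD hs h (List.finRange N) (List.nodup_finRange N) hlam fun m _ => hb m

/-- The points `η n / q` avoid the poles of the exchange relation, so the eigenvalue formulas hold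
there for every label; the same fact gives `d(η n / q) ≠ 0`. -/
theorem Separated.bracket_shift (hs : Separated q η) (n m : Fin N) :
    bracket (η n / q / η m) ≠ 0 := by
  have e : η n / q / η m = (q * (η m / η n))⁻¹ := by
    have := hs.ne n; have := hs.ne m; have := hs.q_ne; field_simp
  rw [e, bracket_inv, neg_ne_zero]
  rcases eq_or_ne m n with rfl | h
  · rw [div_self (hs.ne m), mul_one]; exact hs.bracket_q
  · exact hs.bracket_mul_div m n h

theorem eigenD_div_eq_zero (hs : Separated q η) {h : Config N} {n : Fin N} (hn : h n = 1) :
    eigenD q η (fun m => (h m : ℕ)) (η n / q) = 0 := by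
  refine Finset.prod_eq_zero (Finset.mem_univ n) ?_
  have := hs.ne n; have := hs.q_ne
  have e : q ^ (h n : ℕ) * (η n / q / η n) = 1 := by rw [hn]; simp; field_simp
  rw [e, bracket_one]

theorem eigenD_div_ne_zero (hs : Separated q η) {h : Config N} {n : Fin N} (hn : h n = 0) :
    eigenD q η (fun m => (h m : ℕ)) (η n / q) ≠ 0 := by
  refine Finset.prod_ne_zero_iff.mpr fun m _ => ?_
  rcases Fin.exists_fin_two.mp ⟨h m, rfl⟩ with e | e
  · simpa [e] using hs.bracket_shift n m
  · have hmn : n ≠ m := fun h => by simp_all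
    have e' : q ^ (h m : ℕ) * (η n / q / η m) = η n / η m := by
      have := hs.ne m; have := hs.q_ne
      rw [e]; simp; field_simp
    rw [e']
    exact hs.bracket_div n m hmn

theorem braState_dotProduct_ketState_of_ne (hs : Separated q η) {h k : Config N} (hk : h ≠ k) :
    braState q η h ⬝ᵥ ketState q η k = 0 := by
  obtain ⟨n, hn⟩ := Function.ne_iff.mp hk
  have hb := braState_vecMul_opD hs h (div_ne_zero (hs.ne n) hs.q_ne)
    fun m _ => hs.bracket_shift n m
  have hkt := opD_mulVec_ketState hs k (div_ne_zero (hs.ne n) hs.q_ne)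
    fun m _ => hs.bracket_shift n m
  -- `D(η n / q)` is evaluated to the left and to the right; as `h n ≠ k n`, exactly one of the two
  -- eigenvalues is zero.
  have key := Matrix.dotProduct_mulVec (braState q η h) (opD q η (η n / q)) (ketState q η k)
  rw [hb, hkt, dotProduct_smul, smul_dotProduct, smul_eq_mul, smul_eq_mul] at key
  rcases Fin.exists_fin_two.mp ⟨h n, rfl⟩ with e | e
  · have e' : k n = 1 := by omega
    rw [eigenD_div_eq_zero hs e', zero_mul] at key
    exact (mul_eq_zero.mp key.symm).resolve_left (eigenD_div_ne_zero hs e)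
  · have e' : k n = 0 := by omega
    rw [eigenD_div_eq_zero hs e, zero_mul] at key
    exact (mul_eq_zero.mp key).resolve_left (eigenD_div_ne_zero hs e')

end Eigenvectors

/-! ### Reduction of the states to the shorter chain -/

section Recursion

variable {N : ℕ} {q : ℂ} {η : Fin (N + 1) → ℂ}

/-- The last spin can flip only through `D(η n)` of the shorter chain, which annihilates a state
where site `n` has not been acted on. -/
theorem slice_list_mulVec (hs : Separated q η) (h : Config N) (l : List (Fin N)) (hl : l.Nodup) :
    slice ((l.map fun n => opB q η (η n.castSucc) ^ (h n : ℕ)).prod *ᵥ reference (N + 1)) 0 =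
        (l.map fun n => bracket (q * (η n.castSucc / η (Fin.last N))) ^ (h n : ℕ)).prod •
          ((l.map fun n => opB q (fun n => η n.castSucc) (η n.castSucc) ^ (h n : ℕ)).prod *ᵥ
            reference N) ∧
      slice ((l.map fun n => opB q η (η n.castSucc) ^ (h n : ℕ)).prod *ᵥ reference (N + 1)) 1 =
        0 := by
  induction l with
  | nil => simp [slice_reference_zero, slice_reference_one]
  | cons n l ih =>
    rw [List.nodup_cons] at hl
    obtain ⟨ih0, ih1⟩ := ih hl.2
    simp only [List.map_cons, List.prod_cons, ← Matrix.mulVec_mulVec]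
    rcases Fin.exists_fin_two.mp ⟨h n, rfl⟩ with e | e
    · simp only [e, Fin.val_zero, pow_zero, Matrix.one_mulVec, one_mul]
      exact ⟨ih0, ih1⟩
    · have hD := opD_mulVec_list hs.init h l hl.2 (hs.ne n.castSucc) fun m hm _ =>
        hs.init.bracket_div n m fun e => hl.1 (e ▸ hm)
      rw [eigenD_eq_zero (η := fun n : Fin N => η n.castSucc) (hs.ne n.castSucc)
        (by simp [shifts, hl.1]), zero_smul] at hD
      simp only [e, Fin.val_one, pow_one, slice_opB_mulVec_zero, slice_opB_mulVec_one, ih0, ih1,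
        Matrix.mulVec_smul, hD, Matrix.mulVec_zero, smul_zero, add_zero, smul_smul, and_self]

theorem ketState_append_zero (h : Config N) : ketState q η (append h 0) =
    ((List.finRange N).map fun n => opB q η (η n.castSucc) ^ (h n : ℕ)).prod *ᵥ
      reference (N + 1) := by
  simp [ketState, List.ofFn_succ', ← List.ofFn_eq_map, -List.ofFn_succ]

theorem slice_ketState_append_zero (hs : Separated q η) (h : Config N) :
    slice (ketState q η (append h 0)) 0 =
        (∏ n : Fin N, bracket (q * (η n.castSucc / η (Fin.last N))) ^ (h n : ℕ)) •
          ketState q (fun n => η n.castSucc) h ∧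
      slice (ketState q η (append h 0)) 1 = 0 := by
  rw [ketState_append_zero]
  simpa only [← List.ofFn_eq_map, List.prod_ofFn, ketState] using
    slice_list_mulVec hs h (List.finRange N) (List.nodup_finRange N)

theorem ketState_append_one (hs : Separated q η) (h : Config N) : ketState q η (append h 1) =
    opB q η (η (Fin.last N)) *ᵥ ketState q η (append h 0) := by
  have : Commute (opB q η (η (Fin.last N)))
      ((List.finRange N).map fun n => opB q η (η n.castSucc) ^ (h n : ℕ)).prod := by
    refine Commute.list_prod_right _ _ fun y hy => ?_
    obtain ⟨n, -, rfl⟩ := List.mem_map.mp hy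
    exact (hs.commute_opB _ _).pow_right _
  rw [ketState_append_zero, Matrix.mulVec_mulVec, this.eq]
  simp [ketState, List.ofFn_succ', ← List.ofFn_eq_map, -List.ofFn_succ]

/-- With `B` at the last inhomogeneity acting last, its flipping term is `D` of the shorter chain on
an eigenvector. The up component is not needed, since the matching bra has none. -/
theorem slice_ketState_append_one (hs : Separated q η) (h : Config N) :
    slice (ketState q η (append h 1)) 1 =
      (bracket q * (∏ n : Fin N, bracket (q * (η n.castSucc / η (Fin.last N))) ^ (h n : ℕ)) *
        ∏ n : Fin N, bracket (q ^ (h n : ℕ) * (η (Fin.last N) / η n.castSucc))) •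
          ketState q (fun n => η n.castSucc) h := by
  obtain ⟨h0, h1⟩ := slice_ketState_append_zero hs h
  rw [ketState_append_one hs, slice_opB_mulVec_one, h0, h1, Matrix.mulVec_smul,
    opD_mulVec_ketState hs.init h (hs.ne _) fun m _ =>
      hs.bracket_div _ _ (Fin.castSucc_ne_last m).symm]
  simp [smul_smul, eigenD, mul_assoc]

theorem slice_vecMul_list_zero (h : Config N) (l : List (Fin N)) (u : Bra (N + 1)) :
    slice (u ᵥ* (l.map fun n => opC q η (η n.castSucc) ^ (h n : ℕ)).prod) 0 =
      (l.map fun n => bracket (η n.castSucc / η (Fin.last N)) ^ (h n : ℕ)).prod •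
        (slice u 0 ᵥ*
          (l.map fun n => opC q (fun n => η n.castSucc) (η n.castSucc) ^ (h n : ℕ)).prod) := by
  induction l generalizing u with
  | nil => simp
  | cons n l ih =>
    simp only [List.map_cons, List.prod_cons, ← Matrix.vecMul_vecMul, ih]
    rcases Fin.exists_fin_two.mp ⟨h n, rfl⟩ with e | e
    · simp only [e, Fin.val_zero, pow_zero, Matrix.vecMul_one, one_mul]
    · simp only [e, Fin.val_one, pow_one, slice_vecMul_opC_zero, Matrix.smul_vecMul, smul_smul,
        mul_comm]

/-- The up component feeds the down one through `A`; once it is zero it stays zero, and the down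
component evolves alone. -/
theorem slice_vecMul_list_one (h : Config N) (l : List (Fin N)) (u : Bra (N + 1))
    (hu : slice u 0 = 0) :
    slice (u ᵥ* (l.map fun n => opC q η (η n.castSucc) ^ (h n : ℕ)).prod) 1 =
      (l.map fun n => bracket (q * (η n.castSucc / η (Fin.last N))) ^ (h n : ℕ)).prod •
        (slice u 1 ᵥ*
          (l.map fun n => opC q (fun n => η n.castSucc) (η n.castSucc) ^ (h n : ℕ)).prod) := by
  induction l generalizing u with
  | nil => simp
  | cons n l ih =>
    simp only [List.map_cons, List.prod_cons, ← Matrix.vecMul_vecMul]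
    rcases Fin.exists_fin_two.mp ⟨h n, rfl⟩ with e | e
    · simp only [e, Fin.val_zero, pow_zero, Matrix.vecMul_one, one_mul, ih u hu]
    · simp only [e, Fin.val_one, pow_one]
      rw [ih _ (by rw [slice_vecMul_opC_zero, hu, Matrix.zero_vecMul, smul_zero])]
      simp only [slice_vecMul_opC_one, hu, Matrix.zero_vecMul, smul_zero, zero_add,
        Matrix.smul_vecMul, smul_smul, mul_comm]

theorem slice_braState_append_zero (h : Config N) :
    slice (braState q η (append h 0)) 0 =
      (∏ n : Fin N, bracket (η n.castSucc / η (Fin.last N)) ^ (h n : ℕ)) •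
        braState q (fun n => η n.castSucc) h := by
  have e : braState q η (append h 0) = reference (N + 1) ᵥ*
      ((List.finRange N).map fun n => opC q η (η n.castSucc) ^ (h n : ℕ)).prod := by
    simp [braState, List.ofFn_succ', ← List.ofFn_eq_map, -List.ofFn_succ]
  rw [e, slice_vecMul_list_zero, slice_reference_zero]
  simp only [← List.ofFn_eq_map, List.prod_ofFn, braState]

theorem slice_braState_append_one (hs : Separated q η) (h : Config N) :
    slice (braState q η (append h 1)) 0 = 0 ∧
      slice (braState q η (append h 1)) 1 =
        (bracket q * (∏ n : Fin N, bracket (q * (η (Fin.last N) / η n.castSucc))) *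
          ∏ n : Fin N, bracket (q * (η n.castSucc / η (Fin.last N))) ^ (h n : ℕ)) •
            braState q (fun n => η n.castSucc) h := by
  have hc : Commute (opC q η (η (Fin.last N)))
      ((List.finRange N).map fun n => opC q η (η n.castSucc) ^ (h n : ℕ)).prod := by
    refine Commute.list_prod_right _ _ fun y hy => ?_
    obtain ⟨n, -, rfl⟩ := List.mem_map.mp hy
    exact (hs.commute_opC _ _).pow_right _
  have e : braState q η (append h 1) = (reference (N + 1) ᵥ* opC q η (η (Fin.last N))) ᵥ*
      ((List.finRange N).map fun n => opC q η (η n.castSucc) ^ (h n : ℕ)).prod := by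
    rw [Matrix.vecMul_vecMul, hc.eq]
    simp [braState, List.ofFn_succ', ← List.ofFn_eq_map, -List.ofFn_succ]
  -- `C` at the last inhomogeneity acts first, and its diagonal factor on an up spin is `bracket 1 =
  -- 0`.
  have h0 : slice (reference (N + 1) ᵥ* opC q η (η (Fin.last N))) 0 = 0 := by
    rw [slice_vecMul_opC_zero, div_self (hs.ne _), bracket_one, zero_smul]
  have h1 : slice (reference (N + 1) ᵥ* opC q η (η (Fin.last N))) 1 =
      (bracket q * ∏ n : Fin N, bracket (q * (η (Fin.last N) / η n.castSucc))) •
        reference N := by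
    rw [slice_vecMul_opC_one, slice_reference_zero, slice_reference_one, reference_vecMul_opA,
      Matrix.zero_vecMul, smul_zero, add_zero, smul_smul]
  rw [e]
  constructor
  · rw [slice_vecMul_list_zero, h0, Matrix.zero_vecMul, smul_zero]
  · rw [slice_vecMul_list_one _ _ _ h0, h1]
    simp only [← List.ofFn_eq_map, List.prod_ofFn, braState, Matrix.smul_vecMul, smul_smul]
    rw [mul_comm]

theorem pairProd_succ (r : Fin (N + 1) → Fin (N + 1) → ℂ) :
    pairProd r = pairProd (fun a b : Fin N => r a.castSucc b.castSucc) *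
      ∏ b : Fin N, r (Fin.last N) b.castSucc := by
  simp [pairProd, Fin.prod_univ_castSucc, Finset.prod_filter, Fin.castSucc_lt_last,
    (Fin.castSucc_lt_last _).not_gt]

theorem coeffA_eq {N : ℕ} (q : ℂ) (η : Fin N → ℂ) (lam : ℂ) :
    coeffA q η lam = -∏ n, bracket (q * (lam / η n)) := by
  refine congrArg _ (Finset.prod_congr rfl fun n _ => ?_)
  rw [bracket, ← mul_div_assoc, inv_div, mul_comm q]

theorem coeffD_eq {N : ℕ} (η : Fin N → ℂ) (lam : ℂ) :
    coeffD η lam = ∏ n, bracket (lam / η n) := by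
  simp [coeffD, bracket]

/-- Site-by-site balance of the new factors in the diagonal pairing when the last label is `0`;
`pairing_one` treats label `1`. -/
theorem Separated.pairing_zero (hs : Separated q η) (n : Fin N) (s : Fin 2) :
    bracket (η n.castSucc / η (Fin.last N)) ^ (s : ℕ) *
        bracket (pt q η (Fin.last N) 0 / pt q η n.castSucc s) =
      bracket (η (Fin.last N) / η n.castSucc) *
        bracket (η n.castSucc / q / η (Fin.last N)) ^ (s : ℕ) := by
  have hq := hs.q_ne
  have hn := hs.ne n.castSucc
  have hN := hs.ne (Fin.last N)
  fin_cases s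
  · simp [pt]
  · simp [pt, bracket]
    field_simp
    ring

theorem Separated.pairing_one (hs : Separated q η) (n : Fin N) (s : Fin 2) :
    bracket (q * (η n.castSucc / η (Fin.last N))) ^ (s : ℕ) *
          bracket (q ^ (s : ℕ) * (η (Fin.last N) / η n.castSucc)) *
        bracket (pt q η (Fin.last N) 1 / pt q η n.castSucc s) =
      bracket (η (Fin.last N) / η n.castSucc) *
        bracket (η n.castSucc / q / η (Fin.last N)) ^ (s : ℕ) *
          bracket (η (Fin.last N) / q / η n.castSucc) := by
  have hq := hs.q_ne
  have hn := hs.ne n.castSucc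
  have hN := hs.ne (Fin.last N)
  fin_cases s
  · simp [pt, div_eq_mul_inv]
  · simp [pt, bracket]
    field_simp
    ring

theorem coeffA_succ (q : ℂ) (η : Fin (N + 1) → ℂ) (lam : ℂ) : coeffA q η lam =
    coeffA q (fun n => η n.castSucc) lam * bracket (q * (lam / η (Fin.last N))) := by
  rw [coeffA_eq, coeffA_eq, Fin.prod_univ_castSucc, neg_mul]

theorem coeffD_succ (η : Fin (N + 1) → ℂ) (lam : ℂ) : coeffD η lam =
    coeffD (fun n => η n.castSucc) lam * bracket (lam / η (Fin.last N)) := by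
  rw [coeffD_eq, coeffD_eq, Fin.prod_univ_castSucc]

end Recursion

/-! ### Diagonal pairings -/

theorem braState_dotProduct_ketState_self {q : ℂ} : ∀ {N : ℕ} {η : Fin N → ℂ}
    (_ : Separated q η) (h : Config N),
    (braState q η h ⬝ᵥ ketState q η h) *
        pairProd (fun a b => bracket (pt q η a (h a) / pt q η b (h b))) =
      pairProd (fun a b => bracket (η a / η b)) *
        ∏ n, (coeffA q η (η n) * coeffD η (η n / q)) ^ (h n : ℕ)
  | 0, η, _, h => by
    simp [braState, ketState, pairProd, reference, Subsingleton.elim h 0]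
  | N + 1, η, hs, h => by
    obtain ⟨h, s, rfl⟩ : ∃ h' s, h = append h' s := ⟨_, _, (append_init h).symm⟩
    have ih := braState_dotProduct_ketState_self hs.init h
    have hpt : ∀ n : Fin N, pt q (fun n : Fin N => η n.castSucc) n (h n) =
      pt q η n.castSucc (h n) := fun n => rfl
    simp only [hpt] at ih
    rw [pairProd_succ, pairProd_succ, Fin.prod_univ_castSucc]
    simp only [append_castSucc, append_last, coeffA_succ, coeffD_succ]
    have e : ∏ n : Fin N,
        (coeffA q (fun n : Fin N => η n.castSucc) (η n.castSucc) *
            bracket (q * (η n.castSucc / η (Fin.last N))) *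
          (coeffD (fun n : Fin N => η n.castSucc) (η n.castSucc / q) *
            bracket (η n.castSucc / q / η (Fin.last N)))) ^ (h n : ℕ) =
        (∏ n : Fin N, (coeffA q (fun n : Fin N => η n.castSucc) (η n.castSucc) *
          coeffD (fun n : Fin N => η n.castSucc) (η n.castSucc / q)) ^ (h n : ℕ)) *
        (∏ n : Fin N, bracket (q * (η n.castSucc / η (Fin.last N))) ^ (h n : ℕ)) *
        ∏ n : Fin N, bracket (η n.castSucc / q / η (Fin.last N)) ^ (h n : ℕ) := by
      rw [← Finset.prod_mul_distrib, ← Finset.prod_mul_distrib]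
      exact Finset.prod_congr rfl fun n _ => by rw [← mul_pow, ← mul_pow]; ring
    rw [e]
    clear e
    rcases Fin.exists_fin_two.mp ⟨s, rfl⟩ with rfl | rfl
    · obtain ⟨k0, k1⟩ := slice_ketState_append_zero hs h
      rw [dotProduct_slice, slice_braState_append_zero, k0, k1, dotProduct_zero, add_zero,
        smul_dotProduct, dotProduct_smul, smul_eq_mul, smul_eq_mul]
      have P := Finset.prod_congr rfl fun (n : Fin N) (_ : n ∈ Finset.univ) =>
        hs.pairing_zero n (h n)
      simp only [Finset.prod_mul_distrib] at P
      rw [Fin.val_zero, pow_zero, mul_one]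
      generalize (∏ n : Fin N, bracket (q * (η n.castSucc / η (Fin.last N))) ^ (h n : ℕ)) = Q
      linear_combination
        Q * (∏ n : Fin N, bracket (η n.castSucc / η (Fin.last N)) ^ (h n : ℕ)) *
          (∏ n : Fin N, bracket (pt q η (Fin.last N) 0 / pt q η n.castSucc (h n))) * ih +
        Q * (pairProd fun a b : Fin N => bracket (η a.castSucc / η b.castSucc)) *
          (∏ n : Fin N, (coeffA q (fun n : Fin N => η n.castSucc) (η n.castSucc) *
            coeffD (fun n : Fin N => η n.castSucc) (η n.castSucc / q)) ^ (h n : ℕ)) * P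
    · obtain ⟨b0, b1⟩ := slice_braState_append_one hs h
      rw [dotProduct_slice, slice_ketState_append_one hs, b0, b1, zero_dotProduct, zero_add,
        smul_dotProduct, dotProduct_smul, smul_eq_mul, smul_eq_mul]
      have P := Finset.prod_congr rfl fun (n : Fin N) (_ : n ∈ Finset.univ) =>
        hs.pairing_one n (h n)
      simp only [Finset.prod_mul_distrib] at P
      have hN := hs.ne (Fin.last N)
      have e1 : η (Fin.last N) / q / η (Fin.last N) = q⁻¹ := by field_simp
      -- The sign of `bracket q⁻¹` in `d` cancels the leading sign in `a`, leaving `bracket q ^ 2`,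
      -- one factor each from bra and ket.
      rw [Fin.val_one, pow_one, e1, bracket_inv, div_self hN, mul_one, coeffA_eq, coeffD_eq]
      generalize (∏ n : Fin N, bracket (q * (η n.castSucc / η (Fin.last N))) ^ (h n : ℕ)) = Q
        at P ⊢
      generalize (∏ n : Fin N, bracket (q * (η (Fin.last N) / η n.castSucc))) = R
      linear_combination
        bracket q ^ 2 * R * Q ^ 2 *
          (∏ n : Fin N, bracket (q ^ (h n : ℕ) * (η (Fin.last N) / η n.castSucc))) *
          (∏ n : Fin N, bracket (pt q η (Fin.last N) 1 / pt q η n.castSucc (h n))) * ih +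
        bracket q ^ 2 * R * Q *
          (pairProd fun a b : Fin N => bracket (η a.castSucc / η b.castSucc)) *
          (∏ n : Fin N, (coeffA q (fun n : Fin N => η n.castSucc) (η n.castSucc) *
            coeffD (fun n : Fin N => η n.castSucc) (η n.castSucc / q)) ^ (h n : ℕ)) * P

/-! ### Normalization, Vandermonde determinants and separate states -/

section Separate

variable {N : ℕ} {q : ℂ} {η : Fin N → ℂ}

theorem separated_of_sq_ne (hq : q ≠ 0) (hq2 : q ^ 2 ≠ 1) (hη : ∀ a, η a ≠ 0)
    (hsep : ∀ a b : Fin N, a < b → ∀ j : ℤ, j = -1 ∨ j = 0 ∨ j = 1 →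
      η a ^ 2 ≠ q ^ (2 * j) * η b ^ 2) : Separated q η where
  q_ne := hq
  ne := hη
  bracket_q := by rwa [Ne, bracket_eq_zero_iff hq]
  bracket_div n m h := by
    have hn := hη n
    have hm := hη m
    rw [Ne, bracket_eq_zero_iff (div_ne_zero hn hm), div_pow,
      div_eq_one_iff_eq (pow_ne_zero _ hm)]
    rcases lt_or_gt_of_ne h with h | h
    · simpa using hsep n m h 0 (by simp)
    · simpa using (hsep m n h 0 (by simp)).symm
  bracket_mul_div n m h := by
    have hn := hη n
    have hm := hη m
    rw [Ne, bracket_eq_zero_iff (mul_ne_zero hq (div_ne_zero hn hm)), mul_pow, div_pow,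
      mul_div_assoc', div_eq_one_iff_eq (pow_ne_zero _ hm)]
    intro e
    -- The hypothesis covers only ordered pairs; the two orders correspond to `j = -1` and `j = 1`.
    rcases lt_or_gt_of_ne h with h | h
    · refine hsep n m h (-1) (by simp) ?_
      rw [← e, ← mul_assoc, ← zpow_natCast q 2, ← zpow_add₀ hq]
      simp
    · refine hsep m n h 1 (by simp) ?_
      rw [← e]
      norm_cast

theorem prod_ofFn_smul_pow {A : Type*} [Semiring A] [Algebra ℂ A] :
    ∀ {N : ℕ} (c : Fin N → ℂ) (M : Fin N → A) (h : Fin N → ℕ),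
      (List.ofFn fun n => (c n • M n) ^ h n).prod =
        (∏ n, c n ^ h n) • (List.ofFn fun n => M n ^ h n).prod
  | 0, c, M, h => by simp
  | N + 1, c, M, h => by
    rw [List.ofFn_succ, List.ofFn_succ, List.prod_cons, List.prod_cons, prod_ofFn_smul_pow,
      Fin.prod_univ_succ, smul_pow, smul_mul_smul_comm]

theorem leftSOV_eq (r : Fin N → Fin N → ℂ) (h : Config N) : leftSOV q η r h =
    ((1 / pairProd r) * ∏ n, (1 / coeffD η (η n / q)) ^ (h n : ℕ)) • braState q η h := by
  rw [leftSOV, prod_ofFn_smul_pow, Matrix.vecMul_smul, smul_smul, braState]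

theorem rightSOV_eq (r : Fin N → Fin N → ℂ) (h : Config N) : rightSOV q η r h =
    ((1 / pairProd r) * ∏ n, (1 / coeffA q η (η n)) ^ (h n : ℕ)) • ketState q η h := by
  rw [rightSOV, prod_ofFn_smul_pow, Matrix.smul_mulVec, smul_smul, ketState]

theorem pairProd_mul (r s : Fin N → Fin N → ℂ) :
    pairProd (fun a b => r a b * s a b) = pairProd r * pairProd s := by
  simp only [pairProd, Finset.prod_mul_distrib]

theorem pairProd_congr {r s : Fin N → Fin N → ℂ} (h : ∀ a b, b < a → r a b = s a b) :
    pairProd r = pairProd s :=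
  Finset.prod_congr rfl fun a _ => Finset.prod_congr rfl fun b hb =>
    h a b (Finset.mem_filter.mp hb).2

theorem pairProd_ne_zero {r : Fin N → Fin N → ℂ} (h : ∀ a b, b < a → r a b ≠ 0) :
    pairProd r ≠ 0 :=
  Finset.prod_ne_zero_iff.mpr fun a _ => Finset.prod_ne_zero_iff.mpr fun b hb =>
    h a b (Finset.mem_filter.mp hb).2

/-- Each index lies in exactly `N - 1` pairs. -/
theorem pairProd_mul_eq_prod_omega (x : Fin N → ℂ) (hx : ∀ a, x a ≠ 0) :
    pairProd (fun a b => x a * x b) = ∏ a, omega N (x a) := by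
  induction N with
  | zero => simp [pairProd]
  | succ N ih =>
    rw [pairProd_succ, ih (fun a => x a.castSucc) fun a => hx _, Fin.prod_univ_castSucc]
    have e : ∀ a : Fin N, omega (N + 1) (x a.castSucc) =
        omega N (x a.castSucc) * x a.castSucc := fun a => by
      rw [omega, omega, ← zpow_add_one₀ (hx _)]
      push_cast
      ring_nf
    have e' : omega (N + 1) (x (Fin.last N)) = x (Fin.last N) ^ N := by simp [omega]
    simp only [e, e', Finset.prod_mul_distrib, Finset.prod_const, Finset.card_univ,
      Fintype.card_fin]
    ring

theorem pt_ne_zero (hs : Separated q η) (a : Fin N) (h : Fin 2) : pt q η a h ≠ 0 :=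
  mul_ne_zero (hs.ne a) (zpow_ne_zero _ hs.q_ne)

/-- Pairwise, `x² - y² = x y (x/y - y/x)`. This is where `ω` enters. -/
theorem pairProd_sq_sub (x : Fin N → ℂ) (hx : ∀ a, x a ≠ 0) :
    pairProd (fun a b => x a ^ 2 - x b ^ 2) =
      (∏ a, omega N (x a)) * pairProd (fun a b => bracket (x a / x b)) := by
  rw [← pairProd_mul_eq_prod_omega x hx, ← pairProd_mul]
  refine pairProd_congr fun a b _ => ?_
  have := hx a
  have := hx b
  rw [bracket]
  field_simp

theorem leftSOV_dotProduct_rightSOV_self (hs : Separated q η) {r : Fin N → Fin N → ℂ}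
    (hr : ∀ a b : Fin N, b < a → r a b ^ 2 = η a / η b - η b / η a) (h : Config N) :
    (leftSOV q η r h ⬝ᵥ rightSOV q η r h) *
        pairProd (fun a b => pt q η a (h a) ^ 2 - pt q η b (h b) ^ 2) =
      ∏ a, omega N (pt q η a (h a)) := by
  have h1 : pairProd r * pairProd r = pairProd (fun a b => bracket (η a / η b)) := by
    rw [← pairProd_mul]
    exact pairProd_congr fun a b hab => by rw [← sq, hr a b hab, bracket, inv_div]
  have h2 : pairProd r ≠ 0 := pairProd_ne_zero fun a b hab h0 =>
    hs.bracket_div a b hab.ne' (by rw [bracket, inv_div, ← hr a b hab, h0]; simp)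
  have hA : ∀ n, coeffA q η (η n) ≠ 0 := fun n => by
    rw [coeffA_eq, neg_ne_zero]
    refine Finset.prod_ne_zero_iff.mpr fun m _ => ?_
    rcases eq_or_ne n m with rfl | hnm
    · rw [div_self (hs.ne n), mul_one]; exact hs.bracket_q
    · exact hs.bracket_mul_div n m hnm
  have hD : ∀ n, coeffD η (η n / q) ≠ 0 := fun n => by
    rw [coeffD_eq]
    exact Finset.prod_ne_zero_iff.mpr fun m _ => hs.bracket_shift n m
  have e : (∏ n, (1 / coeffD η (η n / q)) ^ (h n : ℕ)) * (∏ n, (1 / coeffA q η (η n)) ^ (h n : ℕ)) *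
      ∏ n, (coeffA q η (η n) * coeffD η (η n / q)) ^ (h n : ℕ) = 1 := by
    rw [← Finset.prod_mul_distrib, ← Finset.prod_mul_distrib]
    refine Finset.prod_eq_one fun n _ => ?_
    rw [← mul_pow, ← mul_pow]
    have := hA n; have := hD n
    field_simp
    simp
  have key := braState_dotProduct_ketState_self hs h
  rw [leftSOV_eq, rightSOV_eq, smul_dotProduct, dotProduct_smul, smul_eq_mul, smul_eq_mul,
    pairProd_sq_sub _ fun a => pt_ne_zero hs a _]
  rw [← h1] at key
  have e2 : 1 / pairProd r * pairProd r = 1 := by field_simp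
  generalize (∏ a, omega N (pt q η a (h a))) = W
  generalize 1 / pairProd r = I at *
  -- The last coefficient comes from `(I P)² - 1 = (I P + 1)(I P - 1)`, with `P` the normalization
  -- product and `I` its inverse.
  linear_combination W * I ^ 2 * (∏ n, (1 / coeffD η (η n / q)) ^ (h n : ℕ)) *
    (∏ n, (1 / coeffA q η (η n)) ^ (h n : ℕ)) * key + W * I ^ 2 * pairProd r ^ 2 * e +
    W * (I * pairProd r + 1) * e2

theorem leftSOV_dotProduct_rightSOV_of_ne (hs : Separated q η) (r : Fin N → Fin N → ℂ)
    {h k : Config N} (hk : h ≠ k) : leftSOV q η r h ⬝ᵥ rightSOV q η r k = 0 := by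
  rw [leftSOV_eq, rightSOV_eq, smul_dotProduct, dotProduct_smul,
    braState_dotProduct_ketState_of_ne hs hk, smul_zero, smul_zero]

theorem det_vandermonde_eq_pairProd (x : Fin N → ℂ) :
    (Matrix.vandermonde x).det = pairProd (fun a b => x a - x b) := by
  rw [Matrix.det_vandermonde, pairProd]
  refine Finset.prod_comm' fun a b => ?_
  simp

theorem pairingMatrix_apply (α β : Fin N → ℂ → ℂ) (a b : Fin N) :
    pairingMatrix q η α β a b = ∑ h : Fin 2,
      (α a (pt q η a h) * β a (pt q η a h) / omega N (pt q η a h)) *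
        (pt q η a h ^ 2) ^ (b : ℕ) := by
  rw [pairingMatrix, Matrix.of_apply, Finset.mul_sum]
  refine Finset.sum_congr rfl fun h _ => ?_
  have e : (pt q η a h ^ 2) ^ (b : ℕ) =
      η a ^ (2 * (b : ℕ)) * q ^ (-(2 * ((b : ℕ) : ℤ) * ((h : ℕ) : ℤ))) := by
    rw [← pow_mul, pt, mul_pow, ← zpow_natCast (q ^ _), ← zpow_mul]
    congr 2
    push_cast
    ring
  rw [e]
  ring

/-- Expanding every row multilinearly chooses one `h a` per row; each choice yields a Vandermonde
determinant in the squared shifted points. -/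
theorem det_pairingMatrix (α β : Fin N → ℂ → ℂ) :
    (pairingMatrix q η α β).det = ∑ h : Config N,
      (∏ a, α a (pt q η a (h a)) * β a (pt q η a (h a)) / omega N (pt q η a (h a))) *
        pairProd (fun a b => pt q η a (h a) ^ 2 - pt q η b (h b) ^ 2) := by
  have e : pairingMatrix q η α β = fun a => ∑ h : Fin 2,
      (α a (pt q η a h) * β a (pt q η a h) / omega N (pt q η a h)) •
        fun b : Fin N => (pt q η a h ^ 2) ^ (b : ℕ) := by
    ext a b
    rw [pairingMatrix_apply]
    simp
  have := (Matrix.detRowAlternating (R := ℂ) (n := Fin N)).toMultilinearMap.map_sum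
    (fun a (h : Fin 2) => (α a (pt q η a h) * β a (pt q η a h) / omega N (pt q η a h)) •
        fun b : Fin N => (pt q η a h ^ 2) ^ (b : ℕ))
  rw [e]
  refine this.trans (Finset.sum_congr rfl fun h _ => ?_)
  rw [MultilinearMap.map_smul_univ, smul_eq_mul]
  exact congrArg _ (det_vandermonde_eq_pairProd fun a => pt q η a (h a) ^ 2)

theorem leftSeparate_dotProduct_rightSeparate (hs : Separated q η) {r : Fin N → Fin N → ℂ}
    (hr : ∀ a b : Fin N, b < a → r a b ^ 2 = η a / η b - η b / η a) (α β : Fin N → ℂ → ℂ) :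
    leftSeparate q η r α ⬝ᵥ rightSeparate q η r β = (pairingMatrix q η α β).det := by
  rw [det_pairingMatrix, leftSeparate, rightSeparate, sum_dotProduct]
  refine Finset.sum_congr rfl fun h _ => ?_
  rw [dotProduct_sum, Finset.sum_eq_single h, smul_dotProduct, dotProduct_smul, smul_eq_mul,
    smul_eq_mul]
  -- The left and right coefficients each carry a Vandermonde product; `key` absorbs one of them.
  · have key := leftSOV_dotProduct_rightSOV_self hs hr h
    simp only [sepCoeff, Finset.prod_div_distrib, Finset.prod_mul_distrib]
    have hW : ∏ a, omega N (pt q η a (h a)) ≠ 0 :=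
      Finset.prod_ne_zero_iff.mpr fun a _ => zpow_ne_zero _ (pt_ne_zero hs a _)
    generalize (∏ a, omega N (pt q η a (h a))) = W at *
    field_simp
    linear_combination (∏ a, α a (pt q η a (h a))) * (∏ a, β a (pt q η a (h a))) *
      pairProd (fun a b => pt q η a (h a) ^ 2 - pt q η b (h b) ^ 2) * key
  · intro k _ hk
    rw [smul_dotProduct, dotProduct_smul, leftSOV_dotProduct_rightSOV_of_ne hs r hk.symm,
      smul_zero, smul_zero]
  · simp

end Separate

end SixVertex

end

theorem mainTheorem3 (N : ℕ) (q : ℂ) (η : Fin N → ℂ)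
    (hq : q ≠ 0) (hq2 : q ^ 2 ≠ 1) (hη : ∀ a, η a ≠ 0)
    (hsep : ∀ a b : Fin N, a < b → ∀ j : ℤ, j = -1 ∨ j = 0 ∨ j = 1 →
      η a ^ 2 ≠ q ^ (2 * j) * η b ^ 2)
    (r : Fin N → Fin N → ℂ)
    (hr : ∀ a b : Fin N, b < a → r a b ^ 2 = η a / η b - η b / η a)
    (α β : Fin N → ℂ → ℂ) :
    SixVertex.leftSeparate q η r α ⬝ᵥ SixVertex.rightSeparate q η r β =
        (SixVertex.pairingMatrix q η α β).det ∧
      inner ℂ (WithLp.toLp 2 (star (SixVertex.leftSeparate q η r α)))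
          (WithLp.toLp 2 (SixVertex.rightSeparate q η r β)) =
        (SixVertex.pairingMatrix q η α β).det := by
  have h := SixVertex.leftSeparate_dotProduct_rightSeparate
    (SixVertex.separated_of_sq_ne hq hq2 hη hsep) hr α β
  refine ⟨h, ?_⟩
  -- Conjugation in the first argument undoes the `star`, so the Hermitian product is the bilinear
  -- pairing.
  rw [EuclideanSpace.inner_toLp_toLp, star_star, dotProduct_comm]
  exact h
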